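/- Let $c>0$, and let $f$ be a probability density on $[0,1]$ with $f(x)\to c$ as $x\to 0^+$. For $n\ge 2$ concepts let $a_1=1$ and let $a_2,\dots,a_n$ (the overlaps of the other concepts with the concept to be learned, which is the first one) be independent random variables such that each $x_i=1-a_i$ has density $f$. Let $T$ be the random stochastic $n\times n$ matrix of the memoryless learner, $T_{ii}=a_i$ and $T_{ij}=\frac{1-a_i}{n-1}$ for $i\ne j$, and let $$Q(N)=\Big[\big(\tfrac1n,\dots,\tfrac1n\big)\,T^N\Big]_1$$ be the probability that the student, whose initial guess is uniformly distributed, holds the correct concept after $N$ examples. For $0<\Delta<1$ let $N_\Delta$ be the least $N$ with $Q(N)\ge 1-\Delta$. Then $N_\Delta\sim|\log\Delta|\,n\log n$ (same order of growth) with probability tending to $1$ as $n\to\infty$: there are positive constants $C_1,C_2$, not depending on $\Delta$, such that for every $\Delta\in(0,1)$ $$\lim_{n\to\infty}\mathbf P\left(C_1<\frac{N_\Delta}{|\log\Delta|\,n\log n}<C_2\right)=1 .$$ Moreover, let $\mu_*$ be the smallest nonzero eigenvalue of $\frac{n-1}{n}(I-T)$, so that $1-\frac{n}{n-1}\mu_*$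 is the second largest eigenvalue of $T$. Then for every $\varepsilon>0$ $$\lim_{n\to\infty}\mathbf P\left(\left|\frac{\mu_*^{-1}}{n\log n}-c\right|>\varepsilon\right)=0 .$$ -/

import Mathlib

open MeasureTheory ProbabilityTheory Filter Topology
open scoped Matrix

noncomputable section

namespace MemorylessLearner

/-- The transition matrix of the memoryless learner on `n` concepts, where `a i` is the overlap of
the concept `i` with the teacher's concept: the diagonal entries are `a i`, and the off-diagonal
entries of row `i` are `(1 - a i) / (n - 1)`. -/
def transitionMatrix {n : ℕ} (a : Fin n → ℝ) : Matrix (Fin n) (Fin n) ℝ :=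
  Matrix.of fun i j => if i = j then a i else (1 - a i) / ((n : ℝ) - 1)

/-- The distribution of the student's guess after `N` examples, when the initial guess is
uniform: the row vector `(1/n, …, 1/n) T ^ N`. -/
def guessDistribution {n : ℕ} (a : Fin n → ℝ) (N : ℕ) : Fin n → ℝ :=
  (fun _ => 1 / (n : ℝ)) ᵥ* (transitionMatrix a ^ N)

/-- The probability that the student believes in the teacher's concept, which is the concept `0`,
after `N` examples. -/
def learnedProb {m : ℕ} (a : Fin (m + 1) → ℝ) (N : ℕ) : ℝ :=
  guessDistribution a N 0

/-- The least number of examples after which the student has probability at least `1 - Δ` of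
having learned the teacher's concept. (Such a number exists whenever `a 0 = 1`, `0 < Δ`, and all
other overlaps lie in `[0, 1)`; if there is none, the value is `0`.) -/
def learningTime {m : ℕ} (a : Fin (m + 1) → ℝ) (Δ : ℝ) : ℕ :=
  sInf {N : ℕ | 1 - Δ ≤ learnedProb a N}

/-- The matrix `B = D_x (I - J / n)`, where `x i = 1 - a i` and `J` is the all-ones matrix.
It satisfies `B = ((n - 1) / n) (I - T)`, where `T` is the transition matrix. -/
def gapMatrix {n : ℕ} (a : Fin n → ℝ) : Matrix (Fin n) (Fin n) ℝ :=
  Matrix.diagonal (fun i => 1 - a i) * (1 - (1 / (n : ℝ)) • Matrix.of fun _ _ => (1 : ℝ))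

/-- The smallest nonzero eigenvalue `μ_*` of `B`. The second largest eigenvalue of the transition
matrix is `1 - (n / (n - 1)) μ_*`. -/
def muStar {n : ℕ} (a : Fin n → ℝ) : ℝ :=
  sInf {μ : ℝ | μ ≠ 0 ∧ Module.End.HasEigenvalue (Matrix.toLin' (gapMatrix a)) μ}

/-- The overlaps of `m + 1` concepts with the teacher's concept: the teacher's concept itself
comes first and has overlap `1`, the other ones have overlaps `a 0, …, a (m - 1)`. -/
def overlaps (a : ℕ → ℝ) (m : ℕ) : Fin (m + 1) → ℝ :=
  Fin.cons 1 fun i : Fin m => a i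

end MemorylessLearner

end

/-!
Write `x i = 1 - a i` for the gaps and `S = ∑ 1 / x i`, the sum over the concepts other than the
teacher's. The argument has a deterministic and a probabilistic half.

*Deterministic half.* A nonzero eigenvalue `μ` of the gap matrix is either one of the gaps or solves
the secular equation `∑ 1 / (x i - μ) = 1 / μ`. When all gaps are at least `t` and `S * t` is large,
the smallest nonzero eigenvalue is the solution below all gaps, and comparing `1 / (x i - μ)` with
`1 / x i` gives `S ≤ 1 / μ ≤ S / (1 - 1 / (S * t))` (`inv_muStar_bounds`). The corresponding right
eigenvector `x i / (x i - μ)` has mean `1`, vanishes at the teacher's concept and is nearly constant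
on the others. Pairing it with the law of the guess shows that `1 - Q(N)` agrees with the `N`-th
power of the second eigenvalue of the transition matrix up to the factor `1 - μ / t`
(`one_sub_learnedProb_bounds`), so that the learning time is comparable to `|log Δ| * S`
(`learningTime_bounds`). No diagonalisation is needed.

*Probabilistic half.* The variables `1 / x i` are independent with a tail of index `1`, so that `S`
obeys a weak law with the normalisation `n * log n` although its mean is infinite. Truncate at the
level `τ = 1 / (n * √(log n))`. With high probability no gap is below `τ`; the truncated mean is
asymptotic to `c * log (1 / τ)`, hence to `c * log n` (`tendsto_integral_truncInv`); the truncated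
second moment is of order `1 / τ`, small enough for Chebyshev's inequality. Thus `S / (n * log n)`
tends to `c` in probability (`tendsto_measure_compl_goodEvent`). On the same event
`S * τ` is of order `√(log n)`, which is what the deterministic half requires of `t = τ`.
-/

namespace MemorylessLearner

/-! ### The gap matrix and its secular equation -/

/-- The overlaps of `m + 1` concepts, written through the gaps `x i = 1 - a i`: the teacher's
concept comes first and has gap `0`. -/
noncomputable def gapOverlaps {m : ℕ} (x : Fin m → ℝ) : Fin (m + 1) → ℝ :=
  Fin.cons 1 fun i => 1 - x i

/-- The eigenvector of the gap matrix for an eigenvalue `μ` that solves the secular equation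
`∑ i, (x i - μ)⁻¹ = μ⁻¹`, normalised to have mean `1`. -/
noncomputable def secularVector {m : ℕ} (x : Fin m → ℝ) (μ : ℝ) : Fin (m + 1) → ℝ :=
  Fin.cons 0 fun i => x i / (x i - μ)

theorem gapMatrix_mulVec {n : ℕ} (a v : Fin n → ℝ) (i : Fin n) :
    (gapMatrix a *ᵥ v) i = (1 - a i) * (v i - (∑ j, v j) / n) := by
  rw [gapMatrix, ← Matrix.mulVec_mulVec, Matrix.mulVec_diagonal, Matrix.sub_mulVec,
    Matrix.one_mulVec, Matrix.smul_mulVec]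
  simp only [Pi.sub_apply, Pi.smul_apply, Matrix.mulVec, dotProduct, Matrix.of_apply, one_mul,
    smul_eq_mul]
  ring

theorem transitionMatrix_eq {m : ℕ} (hm : 0 < m) (a : Fin (m + 1) → ℝ) :
    transitionMatrix a = 1 - (((m : ℝ) + 1) / m) • gapMatrix a := by
  have hm' : (m : ℝ) ≠ 0 := by positivity
  have hm1 : (m : ℝ) + 1 ≠ 0 := by positivity
  ext i j
  rw [transitionMatrix, gapMatrix, Matrix.of_apply, Matrix.sub_apply, Matrix.smul_apply,
    Matrix.diagonal_mul, Matrix.sub_apply, Matrix.smul_apply, Matrix.of_apply, Matrix.one_apply]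
  split_ifs with h
  · subst h
    push_cast
    simp only [smul_eq_mul]
    field_simp
    ring
  · push_cast
    simp only [smul_eq_mul, add_sub_cancel_right]
    field_simp
    ring

theorem sum_secularVector {m : ℕ} {x : Fin m → ℝ} {μ : ℝ} (hμ : μ ≠ 0)
    (hx : ∀ i, x i ≠ μ) (h : ∑ i, (x i - μ)⁻¹ = μ⁻¹) :
    ∑ i, secularVector x μ i = (m : ℝ) + 1 := by
  have : ∀ i, x i / (x i - μ) = 1 + μ * (x i - μ)⁻¹ := fun i => by
    have := sub_ne_zero.2 (hx i)
    field_simp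
    ring
  simp only [secularVector, Fin.sum_univ_succ, Fin.cons_zero, Fin.cons_succ, this,
    Finset.sum_add_distrib, ← Finset.mul_sum, h, mul_inv_cancel₀ hμ]
  simp

theorem gapMatrix_mulVec_secularVector {m : ℕ} {x : Fin m → ℝ} {μ : ℝ} (hμ : μ ≠ 0)
    (hx : ∀ i, x i ≠ μ) (h : ∑ i, (x i - μ)⁻¹ = μ⁻¹) :
    gapMatrix (gapOverlaps x) *ᵥ secularVector x μ = μ • secularVector x μ := by
  have hm1 : (m : ℝ) + 1 ≠ 0 := by positivity
  ext i
  rw [gapMatrix_mulVec, sum_secularVector hμ hx h]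
  push_cast
  rw [div_self hm1]
  refine Fin.cases ?_ (fun i => ?_) i
  · simp [gapOverlaps, secularVector]
  · have := sub_ne_zero.2 (hx i)
    simp only [gapOverlaps, secularVector, Fin.cons_succ, Pi.smul_apply, smul_eq_mul]
    field_simp
    ring

/-- A solution of the secular equation is an eigenvalue of the gap matrix. -/
theorem hasEigenvalue_of_secular {m : ℕ} {x : Fin m → ℝ} {μ : ℝ} (hμ : μ ≠ 0)
    (hx : ∀ i, x i ≠ μ) (h : ∑ i, (x i - μ)⁻¹ = μ⁻¹) :
    Module.End.HasEigenvalue (Matrix.toLin' (gapMatrix (gapOverlaps x))) μ := by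
  refine Module.End.hasEigenvalue_of_hasEigenvector (x := secularVector x μ) ⟨?_, ?_⟩
  · rw [Module.End.mem_eigenspace_iff, Matrix.toLin'_apply,
      gapMatrix_mulVec_secularVector hμ hx h]
  · intro h0
    have h1 := sum_secularVector hμ hx h
    rw [h0] at h1
    simp only [Pi.zero_apply, Finset.sum_const_zero] at h1
    have : (0 : ℝ) < (m : ℝ) + 1 := by positivity
    linarith

/-- Every nonzero eigenvalue of the gap matrix is one of the gaps (with an eigenvector of mean
zero) or solves the secular equation. -/
theorem eq_gap_or_secular_of_hasEigenvalue {m : ℕ} {x : Fin m → ℝ}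
    {μ : ℝ} (hμ : μ ≠ 0)
    (h : Module.End.HasEigenvalue (Matrix.toLin' (gapMatrix (gapOverlaps x))) μ) :
    (∃ i, x i = μ) ∨ ∑ i, (x i - μ)⁻¹ = μ⁻¹ := by
  obtain ⟨v, hv, hv0⟩ := h.exists_hasEigenvector
  rw [Module.End.mem_eigenspace_iff, Matrix.toLin'_apply] at hv
  by_cases hex : ∃ i, x i = μ
  · exact Or.inl hex
  right
  push Not at hex
  have hm1 : (m : ℝ) + 1 ≠ 0 := by positivity
  set s : ℝ := (∑ j, v j) / (m + 1) with hs
  have hvi : ∀ i, (1 - gapOverlaps x i) * (v i - s) = μ * v i := fun i => by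
    have := congrFun hv i
    rw [gapMatrix_mulVec] at this
    push_cast at this
    simpa using this
  have h0 : v 0 = 0 := by
    have := hvi 0
    simpa [gapOverlaps, hμ] using this
  have hsucc : ∀ i : Fin m, v i.succ = s * (1 + μ * (x i - μ)⁻¹) := fun i => by
    have h1 := hvi i.succ
    have := sub_ne_zero.2 (hex i)
    simp only [gapOverlaps, Fin.cons_succ] at h1
    field_simp
    linarith
  have hs0 : s ≠ 0 := fun hs0 => hv0 <| by
    ext i
    refine Fin.cases h0 (fun i => ?_) i
    rw [hsucc, hs0]
    simp
  have hsum : ∑ j, v j = s * (m + 1) := by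
    rw [hs]
    field_simp
  rw [Fin.sum_univ_succ, h0, zero_add] at hsum
  simp only [hsucc, ← Finset.mul_sum, Finset.sum_add_distrib] at hsum
  have h2 := mul_left_cancel₀ hs0 hsum
  simp only [Finset.sum_const, Finset.card_univ, Fintype.card_fin, nsmul_eq_mul, mul_one,
    add_right_inj] at h2
  exact eq_inv_of_mul_eq_one_right h2

/-! ### Locating the smallest nonzero eigenvalue -/

/-- For `μ` below all gaps, shifting the gaps by `μ` changes the harmonic sum by a factor of at
most `(1 - μ / t)⁻¹`. -/
theorem sum_inv_sub_le {m : ℕ} {x : Fin m → ℝ} {t μ : ℝ} (ht : 0 < t) (hx : ∀ i, t ≤ x i)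
    (hμ0 : 0 ≤ μ) (hμt : μ < t) :
    ∑ i, (x i - μ)⁻¹ ≤ (∑ i, (x i)⁻¹) / (1 - μ / t) := by
  rw [Finset.sum_div]
  refine Finset.sum_le_sum fun i _ => ?_
  have hxi := hx i
  have h1 : 0 < x i := ht.trans_le hxi
  have h2 : 0 < 1 - μ / t := by
    rw [sub_pos, div_lt_one ht]
    exact hμt
  have h3 : x i * (1 - μ / t) ≤ x i - μ := by
    have : μ ≤ x i * (μ / t) := by
      rw [mul_div_assoc', le_div_iff₀ ht, mul_comm]
      exact mul_le_mul_of_nonneg_right hxi hμ0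
    linarith
  rw [div_eq_mul_inv, ← mul_inv]
  exact inv_anti₀ (mul_pos h1 h2) h3

/-- If all gaps are at least `t` and `S = ∑ i, (x i)⁻¹` satisfies `S * t > 1`, then every
nonzero eigenvalue of the gap matrix is at least `S⁻¹ * (1 - (S * t)⁻¹)`. -/
theorem le_of_hasEigenvalue {m : ℕ} {x : Fin m → ℝ} {t S μ : ℝ} (ht : 0 < t)
    (hx : ∀ i, t ≤ x i) (hS : ∑ i, (x i)⁻¹ = S) (hSt : 1 < S * t) (hμ : μ ≠ 0)
    (h : Module.End.HasEigenvalue (Matrix.toLin' (gapMatrix (gapOverlaps x))) μ) :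
    S⁻¹ * (1 - (S * t)⁻¹) ≤ μ := by
  have hS0 : 0 < S := pos_of_mul_pos_left (one_pos.trans hSt) ht.le
  have hSt' : (S * t)⁻¹ < 1 := inv_lt_one_of_one_lt₀ hSt
  have hSt0 : 0 < (S * t)⁻¹ := by positivity
  have hL1 : S⁻¹ * (1 - (S * t)⁻¹) < S⁻¹ := by
    have : 0 < S⁻¹ := by positivity
    nlinarith
  have hLt : S⁻¹ < t := by
    rw [inv_lt_iff_one_lt_mul₀ hS0]
    linarith
  by_contra! hlt
  rcases eq_gap_or_secular_of_hasEigenvalue hμ h with ⟨i, hi⟩ | hsec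
  · have := hx i
    linarith
  rcases lt_or_gt_of_ne hμ with hneg | hpos
  · have h1 : 0 ≤ ∑ i, (x i - μ)⁻¹ := Finset.sum_nonneg fun i _ => by
      have := hx i
      exact inv_nonneg.2 (by linarith)
    rw [hsec] at h1
    exact absurd (inv_lt_zero.2 hneg) (not_lt.2 h1)
  · have hμt : μ < t := by linarith
    have h1 := sum_inv_sub_le ht hx hpos.le hμt
    rw [hsec, hS] at h1
    have h2 : 0 < 1 - μ / t := by
      rw [sub_pos, div_lt_one ht]
      exact hμt
    rw [le_div_iff₀ h2, inv_mul_le_iff₀ hpos] at h1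
    have h3 : μ * S < 1 - (S * t)⁻¹ := by
      have := mul_lt_mul_of_pos_right hlt hS0
      rwa [mul_comm S⁻¹, mul_assoc, inv_mul_cancel₀ hS0.ne', mul_one] at this
    have h4 : μ / t < (S * t)⁻¹ := by
      rw [mul_inv, ← div_eq_mul_inv]
      exact div_lt_div_of_pos_right (hlt.trans hL1) ht
    linarith

/-- The secular equation has a solution close to the reciprocal of `∑ i, (x i)⁻¹`. -/
theorem exists_secular {m : ℕ} {x : Fin m → ℝ} {t S : ℝ} (ht : 0 < t)
    (hx : ∀ i, t ≤ x i) (hS : ∑ i, (x i)⁻¹ = S) (hSt : 1 < S * t) :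
    ∃ μ, S⁻¹ * (1 - (S * t)⁻¹) ≤ μ ∧ μ ≤ S⁻¹ ∧ ∑ i, (x i - μ)⁻¹ = μ⁻¹ := by
  have hS0 : 0 < S := pos_of_mul_pos_left (one_pos.trans hSt) ht.le
  have hSi : 0 < S⁻¹ := by positivity
  have hSt' : (S * t)⁻¹ < 1 := inv_lt_one_of_one_lt₀ hSt
  have hSt0 : 0 < (S * t)⁻¹ := by positivity
  have hLt : S⁻¹ < t := by
    rw [inv_lt_iff_one_lt_mul₀ hS0]
    linarith
  set L := S⁻¹ * (1 - (S * t)⁻¹) with hL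
  have hL0 : 0 < L := mul_pos hSi (by linarith)
  have hL1 : L < S⁻¹ := by nlinarith
  have hcont : ContinuousOn (fun μ => μ * ∑ i, (x i - μ)⁻¹) (Set.Icc L S⁻¹) := by
    refine continuousOn_id.mul (continuousOn_finsetSum _ fun i _ => ?_)
    refine (continuousOn_const.sub continuousOn_id).inv₀ fun μ hμ => ?_
    have := hx i
    have := hμ.2
    exact sub_ne_zero.2 (by simp only [id]; linarith)
  have hlow : L * ∑ i, (x i - L)⁻¹ ≤ 1 := by
    have h1 := sum_inv_sub_le ht hx hL0.le (hL1.trans hLt)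
    rw [hS] at h1
    have h2 : 0 < 1 - L / t := by
      rw [sub_pos, div_lt_one ht]
      linarith
    have h3 : L / t ≤ (S * t)⁻¹ := by
      rw [mul_inv, ← div_eq_mul_inv]
      exact div_le_div_of_nonneg_right hL1.le ht.le
    have h4 : L * S = 1 - (S * t)⁻¹ := by
      rw [hL, mul_comm S⁻¹, mul_assoc, inv_mul_cancel₀ hS0.ne', mul_one]
    calc _ ≤ L * (S / (1 - L / t)) := mul_le_mul_of_nonneg_left h1 hL0.le
      _ = L * S / (1 - L / t) := by ring
      _ ≤ 1 := by rw [div_le_one h2]; linarith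
  have hhigh : 1 ≤ S⁻¹ * ∑ i, (x i - S⁻¹)⁻¹ := by
    have h1 : S ≤ ∑ i, (x i - S⁻¹)⁻¹ := by
      rw [← hS]
      refine Finset.sum_le_sum fun i _ => ?_
      have := hx i
      rw [hS]
      exact inv_anti₀ (by linarith) (by linarith)
    calc (1 : ℝ) = S⁻¹ * S := (inv_mul_cancel₀ hS0.ne').symm
      _ ≤ _ := mul_le_mul_of_nonneg_left h1 hSi.le
  obtain ⟨μ, ⟨hμ1, hμ2⟩, hμ⟩ := intermediate_value_Icc hL1.le hcont ⟨hlow, hhigh⟩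
  exact ⟨μ, hμ1, hμ2, eq_inv_of_mul_eq_one_right hμ⟩

theorem muStar_mem_Icc {m : ℕ} {x : Fin m → ℝ} {t S : ℝ} (ht : 0 < t)
    (hx : ∀ i, t ≤ x i) (hS : ∑ i, (x i)⁻¹ = S) (hSt : 1 < S * t) :
    muStar (gapOverlaps x) ∈ Set.Icc (S⁻¹ * (1 - (S * t)⁻¹)) S⁻¹ := by
  obtain ⟨μ, hμ1, hμ2, hμ⟩ := exists_secular ht hx hS hSt
  have hS0 : 0 < S := pos_of_mul_pos_left (one_pos.trans hSt) ht.le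
  have hL0 : 0 < S⁻¹ * (1 - (S * t)⁻¹) :=
    mul_pos (by positivity) (sub_pos.2 (inv_lt_one_of_one_lt₀ hSt))
  have hLt : S⁻¹ < t := by
    rw [inv_lt_iff_one_lt_mul₀ hS0]
    linarith
  have hμ0 : μ ≠ 0 := by linarith
  have hmem : μ ∈ {μ : ℝ | μ ≠ 0 ∧
      Module.End.HasEigenvalue (Matrix.toLin' (gapMatrix (gapOverlaps x))) μ} :=
    ⟨hμ0, hasEigenvalue_of_secular hμ0 (fun i => by have := hx i; linarith) hμ⟩
  have hlb : ∀ ν ∈ {μ : ℝ | μ ≠ 0 ∧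
      Module.End.HasEigenvalue (Matrix.toLin' (gapMatrix (gapOverlaps x))) μ},
      S⁻¹ * (1 - (S * t)⁻¹) ≤ ν :=
    fun ν hν => le_of_hasEigenvalue ht hx hS hSt hν.1 hν.2
  exact ⟨le_csInf ⟨μ, hmem⟩ hlb, (csInf_le ⟨_, hlb⟩ hmem).trans hμ2⟩

/-! ### The probability of having learned the concept -/

theorem transitionMatrix_nonneg {m : ℕ} {a : Fin (m + 1) → ℝ} (h0 : ∀ i, 0 ≤ a i)
    (h1 : ∀ i, a i ≤ 1) (i j : Fin (m + 1)) : 0 ≤ transitionMatrix a i j := by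
  rw [transitionMatrix, Matrix.of_apply]
  split_ifs
  · exact h0 i
  · have := h1 i
    push_cast
    rw [add_sub_cancel_right]
    exact div_nonneg (by linarith) (by positivity)

theorem pow_mulVec_of_mulVec_eq_smul {n : ℕ} {A : Matrix (Fin n) (Fin n) ℝ} {v : Fin n → ℝ}
    {r : ℝ} (h : A *ᵥ v = r • v) (N : ℕ) : (A ^ N) *ᵥ v = r ^ N • v := by
  induction N with
  | zero => simp
  | succ N ih => rw [pow_succ, ← Matrix.mulVec_mulVec, h, Matrix.mulVec_smul, ih, smul_smul,
      pow_succ, mul_comm]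

theorem guessDistribution_dotProduct {n : ℕ} {a v : Fin n → ℝ}
    {r : ℝ} (h : transitionMatrix a *ᵥ v = r • v) (N : ℕ) :
    guessDistribution a N ⬝ᵥ v = r ^ N * ((∑ i, v i) / n) := by
  rw [guessDistribution, ← Matrix.dotProduct_mulVec, pow_mulVec_of_mulVec_eq_smul h,
    dotProduct_smul, smul_eq_mul]
  simp only [dotProduct, ← Finset.mul_sum]
  ring

theorem guessDistribution_nonneg {m : ℕ} {a : Fin (m + 1) → ℝ} (h0 : ∀ i, 0 ≤ a i)
    (h1 : ∀ i, a i ≤ 1) (N : ℕ) (j : Fin (m + 1)) : 0 ≤ guessDistribution a N j := by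
  induction N generalizing j with
  | zero =>
    simp only [guessDistribution, pow_zero, Matrix.vecMul_one]
    positivity
  | succ N ih =>
    have : guessDistribution a (N + 1) = guessDistribution a N ᵥ* transitionMatrix a := by
      rw [guessDistribution, guessDistribution, pow_succ, Matrix.vecMul_vecMul]
    rw [this]
    simp only [Matrix.vecMul, dotProduct]
    exact Finset.sum_nonneg fun i _ => mul_nonneg (ih i) (transitionMatrix_nonneg h0 h1 i j)

/-- Pairing the law of the guess with the eigenvector of a secular eigenvalue `μ`, whose entries
off the teacher's concept lie between `1` and `(1 - μ / t)⁻¹`, shows that the probability of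
not having learned the concept is the `N`-th power of the second eigenvalue up to the factor
`1 - μ / t`. -/
theorem one_sub_learnedProb_bounds {m : ℕ} (hm : 0 < m) {x : Fin m → ℝ} {t μ : ℝ} (ht : 0 < t)
    (hx : ∀ i, t ≤ x i) (hx1 : ∀ i, x i ≤ 1) (hμ0 : 0 < μ) (hμt : μ < t)
    (h : ∑ i, (x i - μ)⁻¹ = μ⁻¹) (N : ℕ) :
    1 - learnedProb (gapOverlaps x) N ≤ (1 - ((m : ℝ) + 1) / m * μ) ^ N ∧
    (1 - ((m : ℝ) + 1) / m * μ) ^ N * (1 - μ / t) ≤ 1 - learnedProb (gapOverlaps x) N := by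
  have hne : ∀ i, x i ≠ μ := fun i => by have := hx i; linarith
  have hm1 : (m : ℝ) + 1 ≠ 0 := by positivity
  have hT : ∀ v r, gapMatrix (gapOverlaps x) *ᵥ v = r • v →
      transitionMatrix (gapOverlaps x) *ᵥ v = (1 - ((m : ℝ) + 1) / m * r) • v := fun v r hv => by
    rw [transitionMatrix_eq hm, Matrix.sub_mulVec, Matrix.one_mulVec, Matrix.smul_mulVec, hv,
      smul_smul, sub_smul, one_smul]
  set p := guessDistribution (gapOverlaps x) N with hp
  have hp0 : ∀ j, 0 ≤ p j := by
    refine guessDistribution_nonneg (fun i => ?_) (fun i => ?_) N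
    · refine Fin.cases (by simp [gapOverlaps]) (fun i => ?_) i
      simpa [gapOverlaps] using hx1 i
    · refine Fin.cases (by simp [gapOverlaps]) (fun i => ?_) i
      simpa [gapOverlaps] using ht.le.trans (hx i)
  have hone : p ⬝ᵥ (fun _ => (1 : ℝ)) = 1 := by
    have hs : (∑ _i : Fin (m + 1), (1 : ℝ)) / ((m + 1 : ℕ) : ℝ) = 1 := by simp [hm1]
    rw [hp, guessDistribution_dotProduct (hT (fun _ => (1 : ℝ)) 0 ?_), hs]
    · simp
    · ext i
      rw [gapMatrix_mulVec, hs]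
      simp
  have hsec : p ⬝ᵥ secularVector x μ = (1 - ((m : ℝ) + 1) / m * μ) ^ N := by
    rw [guessDistribution_dotProduct (hT _ _ (gapMatrix_mulVec_secularVector hμ0.ne' hne h)),
      sum_secularVector hμ0.ne' hne h]
    push_cast
    rw [div_self (by positivity), mul_one]
  rw [dotProduct, Fin.sum_univ_succ] at hone hsec
  simp only [secularVector, Fin.cons_zero, Fin.cons_succ, mul_zero, zero_add, mul_one]
    at hone hsec
  have hQ : 1 - learnedProb (gapOverlaps x) N = ∑ i : Fin m, p i.succ := by
    rw [learnedProb, ← hp]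
    linarith
  rw [hQ, ← hsec, Finset.sum_mul]
  have h2 : 0 < 1 - μ / t := by
    rw [sub_pos, div_lt_one ht]
    exact hμt
  constructor
  · refine Finset.sum_le_sum fun i _ => le_mul_of_one_le_right (hp0 _) ?_
    have := hx i
    rw [one_le_div (by linarith)]
    linarith
  · refine Finset.sum_le_sum fun i _ => ?_
    rw [mul_assoc]
    refine mul_le_of_le_one_right (hp0 _) ?_
    have hxi := hx i
    rw [div_mul_eq_mul_div, div_le_one (by linarith), mul_sub, mul_one]
    have : μ ≤ x i * (μ / t) := by
      rw [mul_div_assoc', le_div_iff₀ ht, mul_comm]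
      exact mul_le_mul_of_nonneg_right hxi hμ0.le
    linarith

/-! ### Learning time and second eigenvalue in terms of the harmonic sum of the gaps -/

/-- The learning time is attained as a minimum, since the second eigenvalue is less than `1`, and
`(1 - μ) ^ N ≤ exp (-μ * N)`. -/
theorem learningTime_le {m : ℕ} (hm : 0 < m) {x : Fin m → ℝ} {t μ Δ : ℝ} (ht : 0 < t)
    (hx : ∀ i, t ≤ x i) (hx1 : ∀ i, x i ≤ 1) (hμ0 : 0 < μ) (hμt : μ < t) (hμ4 : μ ≤ 1 / 4)
    (h : ∑ i, (x i - μ)⁻¹ = μ⁻¹) (hΔ0 : 0 < Δ) (hΔ1 : Δ < 1) :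
    (∃ N, 1 - Δ ≤ learnedProb (gapOverlaps x) N) ∧
    (learningTime (gapOverlaps x) Δ : ℝ) ≤ |Real.log Δ| * μ⁻¹ + 1 := by
  have hm' : (1 : ℝ) ≤ m := by exact_mod_cast hm
  have hr1 : 1 ≤ ((m : ℝ) + 1) / m := by
    rw [one_le_div (by linarith)]
    linarith
  have hr2 : ((m : ℝ) + 1) / m ≤ 2 := by
    rw [div_le_iff₀ (by linarith)]
    linarith
  have hlog : Real.log Δ < 0 := Real.log_neg hΔ0 hΔ1
  set N := ⌈|Real.log Δ| * μ⁻¹⌉₊ with hN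
  have hN1 : |Real.log Δ| * μ⁻¹ ≤ N := Nat.le_ceil _
  have hN2 : (N : ℝ) < |Real.log Δ| * μ⁻¹ + 1 := Nat.ceil_lt_add_one (by positivity)
  have hpow : (1 - ((m : ℝ) + 1) / m * μ) ^ N ≤ Δ := by
    have h1 : 1 - ((m : ℝ) + 1) / m * μ ≤ Real.exp (-μ) := by
      have := Real.add_one_le_exp (-μ)
      nlinarith
    have h2 : 0 ≤ 1 - ((m : ℝ) + 1) / m * μ := by nlinarith
    calc _ ≤ Real.exp (-μ) ^ N := pow_le_pow_left₀ h2 h1 N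
      _ = Real.exp (N * (-μ)) := (Real.exp_nat_mul _ _).symm
      _ ≤ Real.exp (Real.log Δ) := by
        refine Real.exp_le_exp.2 ?_
        rw [abs_of_neg hlog, ← div_eq_mul_inv, div_le_iff₀ hμ0] at hN1
        linarith
      _ = Δ := Real.exp_log hΔ0
  have hmem : 1 - Δ ≤ learnedProb (gapOverlaps x) N := by
    have := (one_sub_learnedProb_bounds hm ht hx hx1 hμ0 hμt h N).1
    linarith
  refine ⟨⟨N, hmem⟩, ?_⟩
  have h3 : learningTime (gapOverlaps x) Δ ≤ N := Nat.sInf_le hmem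
  have h4 : (learningTime (gapOverlaps x) Δ : ℝ) ≤ N := by exact_mod_cast h3
  linarith

/-- The factor `1 - μ / t` in the lower bound for `1 - learnedProb` costs at most half of
`|log Δ|` once it is at least `√Δ`; then `(1 - 2 * μ) ^ N ≤ √Δ` bounds `N` from below. -/
theorem le_learningTime {m : ℕ} (hm : 0 < m) {x : Fin m → ℝ} {t μ Δ : ℝ} (ht : 0 < t)
    (hx : ∀ i, t ≤ x i) (hx1 : ∀ i, x i ≤ 1) (hμ0 : 0 < μ) (hμt : μ < t) (hμ4 : μ ≤ 1 / 4)
    (h : ∑ i, (x i - μ)⁻¹ = μ⁻¹) (hΔ0 : 0 < Δ) (hΔ1 : Δ < 1) (hΔμ : √Δ ≤ 1 - μ / t) :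
    |Real.log Δ| / 2 * (μ⁻¹ / 2 - 1) ≤ learningTime (gapOverlaps x) Δ := by
  have hm' : (1 : ℝ) ≤ m := by exact_mod_cast hm
  have hr2 : ((m : ℝ) + 1) / m ≤ 2 := by
    rw [div_le_iff₀ (by linarith)]
    linarith
  have hlog : Real.log Δ < 0 := Real.log_neg hΔ0 hΔ1
  have hmem : 1 - Δ ≤ learnedProb (gapOverlaps x) (learningTime (gapOverlaps x) Δ) :=
    Nat.sInf_mem (s := {N : ℕ | 1 - Δ ≤ learnedProb (gapOverlaps x) N})
      (learningTime_le hm ht hx hx1 hμ0 hμt hμ4 h hΔ0 hΔ1).1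
  set N := learningTime (gapOverlaps x) Δ
  have h1 := (one_sub_learnedProb_bounds hm ht hx hx1 hμ0 hμt h N).2
  have hs : 0 < √Δ := Real.sqrt_pos.2 hΔ0
  have h0 : 0 < 1 - 2 * μ := by linarith
  have h2 : 1 - 2 * μ ≤ 1 - ((m : ℝ) + 1) / m * μ := by nlinarith
  have hpow : (1 - 2 * μ) ^ N ≤ √Δ := by
    have h3 : (1 - 2 * μ) ^ N * √Δ ≤ √Δ * √Δ := by
      rw [Real.mul_self_sqrt hΔ0.le]
      calc _ ≤ (1 - ((m : ℝ) + 1) / m * μ) ^ N * (1 - μ / t) :=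
            mul_le_mul (pow_le_pow_left₀ h0.le h2 N) hΔμ hs.le
              (pow_nonneg (h0.le.trans h2) N)
        _ ≤ Δ := by linarith
    exact le_of_mul_le_mul_right h3 hs
  have h4 : N * Real.log (1 - 2 * μ) ≤ Real.log Δ / 2 := by
    rw [← Real.log_pow, ← Real.log_sqrt hΔ0.le]
    exact Real.log_le_log (pow_pos h0 N) hpow
  have h5 : 1 - (1 - 2 * μ)⁻¹ ≤ Real.log (1 - 2 * μ) := Real.one_sub_inv_le_log_of_pos h0
  have h6 : |Real.log Δ| / 2 ≤ N * (2 * μ / (1 - 2 * μ)) := by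
    have h7 : 1 - (1 - 2 * μ)⁻¹ = -(2 * μ / (1 - 2 * μ)) := by
      field_simp
      ring
    rw [h7] at h5
    have := mul_le_mul_of_nonneg_left h5 (Nat.cast_nonneg (α := ℝ) N)
    rw [abs_of_neg hlog]
    linarith
  have h8 : μ⁻¹ / 2 - 1 = ((2 * μ) / (1 - 2 * μ))⁻¹ := by
    field_simp
  rw [h8, ← div_eq_mul_inv]
  exact (div_le_iff₀ (by positivity)).2 h6

theorem learningTime_bounds {m : ℕ} {x : Fin m → ℝ} {t S Δ : ℝ} (ht : 0 < t)
    (hx : ∀ i, t ≤ x i) (hx1 : ∀ i, x i ≤ 1) (hS : ∑ i, (x i)⁻¹ = S) (hSt : 2 ≤ S * t)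
    (hS4 : 4 ≤ S) (hΔ0 : 0 < Δ) (hΔ1 : Δ < 1) (hΔS : √Δ ≤ 1 - (S * t)⁻¹) :
    |Real.log Δ| * S / 8 ≤ learningTime (gapOverlaps x) Δ ∧
    (learningTime (gapOverlaps x) Δ : ℝ) ≤ 2 * |Real.log Δ| * S + 1 := by
  have hm : 0 < m := by
    rcases Nat.eq_zero_or_pos m with rfl | hm
    · simp at hS
      linarith
    · exact hm
  obtain ⟨μ, hμ1, hμ2, hμ⟩ := exists_secular ht hx hS (by linarith)
  have hS0 : 0 < S := by linarith
  have hinv : (S * t)⁻¹ ≤ 1 / 2 := by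
    rw [one_div]
    exact inv_anti₀ two_pos hSt
  have hSi : 0 < S⁻¹ := by positivity
  have hμ1' : S⁻¹ / 2 ≤ μ := by nlinarith
  have hμ0 : 0 < μ := by linarith
  have hSit : S⁻¹ < t := by
    rw [inv_lt_iff_one_lt_mul₀ hS0]
    linarith
  have hμt : μ < t := by linarith
  have hμ4 : μ ≤ 1 / 4 := hμ2.trans (by rw [one_div]; exact inv_anti₀ (by norm_num) hS4)
  have hμS : S ≤ μ⁻¹ := by
    have := inv_anti₀ hμ0 hμ2
    rwa [inv_inv] at this
  have hμS' : μ⁻¹ ≤ 2 * S := by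
    have := inv_anti₀ (by positivity) hμ1'
    rwa [inv_div, div_inv_eq_mul] at this
  have hΔμ : √Δ ≤ 1 - μ / t := by
    have : μ / t ≤ (S * t)⁻¹ := by
      rw [mul_inv, ← div_eq_mul_inv]
      exact div_le_div_of_nonneg_right hμ2 ht.le
    linarith
  have habs := abs_nonneg (Real.log Δ)
  constructor
  · refine le_trans ?_ (le_learningTime hm ht hx hx1 hμ0 hμt hμ4 hμ hΔ0 hΔ1 hΔμ)
    nlinarith
  · refine (learningTime_le hm ht hx hx1 hμ0 hμt hμ4 hμ hΔ0 hΔ1).2.trans ?_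
    nlinarith

theorem inv_muStar_bounds {m : ℕ} {x : Fin m → ℝ} {t S : ℝ} (ht : 0 < t)
    (hx : ∀ i, t ≤ x i) (hS : ∑ i, (x i)⁻¹ = S) (hSt : 1 < S * t) :
    S ≤ (muStar (gapOverlaps x))⁻¹ ∧
    (muStar (gapOverlaps x))⁻¹ ≤ S / (1 - (S * t)⁻¹) := by
  obtain ⟨h1, h2⟩ := muStar_mem_Icc ht hx hS hSt
  have hS0 : 0 < S := pos_of_mul_pos_left (one_pos.trans hSt) ht.le
  have hL0 : 0 < S⁻¹ * (1 - (S * t)⁻¹) :=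
    mul_pos (by positivity) (sub_pos.2 (inv_lt_one_of_one_lt₀ hSt))
  constructor
  · have := inv_anti₀ (hL0.trans_le h1) h2
    rwa [inv_inv] at this
  · have := inv_anti₀ hL0 h1
    rwa [mul_inv, inv_inv, ← div_eq_mul_inv] at this

/-! ### Truncated moments of the reciprocal of a gap -/

/-- The reciprocal, truncated to `0` on `(-∞, τ]`. -/
noncomputable def truncInv (τ : ℝ) : ℝ → ℝ :=
  (Set.Ioi τ).indicator fun x => x⁻¹

/-- The measure `ν` has density close to `c` on a right neighbourhood of `0`, in the sense of an
inequality between measures. -/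
def HasDensityAtZero (ν : Measure ℝ) (c : ℝ) : Prop :=
  ∀ η, 0 < η → ∃ δ, 0 < δ ∧
    ENNReal.ofReal (c - η) • volume.restrict (Set.Ioo 0 δ) ≤ ν.restrict (Set.Ioo 0 δ) ∧
    ν.restrict (Set.Ioo 0 δ) ≤ ENNReal.ofReal (c + η) • volume.restrict (Set.Ioo 0 δ)

theorem hasDensityAtZero_withDensity {f : ℝ → ℝ} {c : ℝ} (hfc : Tendsto f (𝓝[>] 0) (𝓝 c)) :
    HasDensityAtZero
      ((volume.restrict (Set.Icc (0 : ℝ) 1)).withDensity fun x => ENNReal.ofReal (f x)) c := by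
  intro η hη
  have h1 : ∀ᶠ x in 𝓝[>] (0 : ℝ), c - η < f x ∧ f x < c + η :=
    hfc.eventually (Ioo_mem_nhds (by linarith) (by linarith))
  obtain ⟨δ, hδ0, hδ⟩ := mem_nhdsGT_iff_exists_Ioo_subset.1 h1
  refine ⟨min δ 1, lt_min hδ0 one_pos, ?_⟩
  have hsub : Set.Ioo 0 (min δ 1) ∩ Set.Icc (0 : ℝ) 1 = Set.Ioo 0 (min δ 1) :=
    Set.inter_eq_left.2 fun x hx => ⟨hx.1.le, hx.2.le.trans (min_le_right _ _)⟩
  rw [restrict_withDensity measurableSet_Ioo, Measure.restrict_restrict measurableSet_Ioo, hsub,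
    ← withDensity_const, ← withDensity_const]
  have hmem : ∀ᵐ x ∂(volume.restrict (Set.Ioo 0 (min δ 1))), c - η < f x ∧ f x < c + η := by
    filter_upwards [ae_restrict_mem measurableSet_Ioo] with x hx
    exact hδ ⟨hx.1, hx.2.trans_le (min_le_left _ _)⟩
  constructor
  · refine withDensity_mono ?_
    filter_upwards [hmem] with x hx
    exact ENNReal.ofReal_le_ofReal hx.1.le
  · refine withDensity_mono ?_
    filter_upwards [hmem] with x hx
    exact ENNReal.ofReal_le_ofReal hx.2.le

theorem measurable_truncInv (τ : ℝ) : Measurable (truncInv τ) :=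
  measurable_inv.indicator measurableSet_Ioi

theorem truncInv_nonneg {τ : ℝ} (hτ : 0 ≤ τ) (x : ℝ) : 0 ≤ truncInv τ x :=
  Set.indicator_nonneg (fun _ hy => inv_nonneg.2 (hτ.trans (le_of_lt hy))) x

theorem truncInv_le {τ : ℝ} (hτ : 0 < τ) (x : ℝ) : truncInv τ x ≤ τ⁻¹ := by
  rw [truncInv, Set.indicator_apply]
  split_ifs with h
  · exact inv_anti₀ hτ (le_of_lt h)
  · positivity

theorem truncInv_of_lt {τ x : ℝ} (h : τ < x) : truncInv τ x = x⁻¹ :=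
  Set.indicator_of_mem (s := Set.Ioi τ) h _

theorem truncInv_eq_add {τ δ : ℝ} (h : τ < δ) (x : ℝ) :
    truncInv τ x = (Set.Ioc τ δ).indicator (fun x => x⁻¹) x + truncInv δ x := by
  have : Set.Ioi τ = Set.Ioc τ δ ∪ Set.Ioi δ := (Set.Ioc_union_Ioi_eq_Ioi h.le).symm
  rw [truncInv, this, Set.indicator_union_of_disjoint]
  · rfl
  · rw [Set.disjoint_left]
    exact fun y hy hy' => not_lt.2 hy.2 hy'

theorem integrable_truncInv_pow {ν : Measure ℝ} [IsProbabilityMeasure ν] {τ : ℝ} (hτ : 0 < τ)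
    (k : ℕ) : Integrable (fun x => truncInv τ x ^ k) ν := by
  refine Integrable.of_bound ((measurable_truncInv τ).pow_const k).aestronglyMeasurable (τ⁻¹ ^ k)
    (ae_of_all _ fun x => ?_)
  rw [Real.norm_of_nonneg (pow_nonneg (truncInv_nonneg hτ.le x) k)]
  exact pow_le_pow_left₀ (truncInv_nonneg hτ.le x) (truncInv_le hτ x) k

/-- Cutting off at `δ` costs at most a constant: only the part of `ν` close to `0` matters. -/
theorem integral_truncInv_pow_bounds {ν : Measure ℝ} [IsProbabilityMeasure ν] {τ δ : ℝ}
    (hτ : 0 < τ) (hτδ : τ < δ) {k : ℕ} (hk : k ≠ 0) :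
    ∫ x in Set.Ioc τ δ, x⁻¹ ^ k ∂ν ≤ ∫ x, truncInv τ x ^ k ∂ν ∧
    ∫ x, truncInv τ x ^ k ∂ν ≤ ∫ x in Set.Ioc τ δ, x⁻¹ ^ k ∂ν + δ⁻¹ ^ k := by
  have hδ : 0 < δ := hτ.trans hτδ
  have hpt : ∀ x, truncInv τ x ^ k =
      (Set.Ioc τ δ).indicator (fun x => x⁻¹ ^ k) x + truncInv δ x ^ k := fun x => by
    rw [truncInv_eq_add hτδ x]
    by_cases hx : x ∈ Set.Ioc τ δ
    · have : truncInv δ x = 0 :=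
        Set.indicator_of_notMem (s := Set.Ioi δ) (fun h => not_lt.2 hx.2 h) _
      rw [this, Set.indicator_of_mem hx, Set.indicator_of_mem hx, zero_pow hk, add_zero, add_zero]
    · rw [Set.indicator_of_notMem hx, Set.indicator_of_notMem hx, zero_add, zero_add]
  have hi2 := integrable_truncInv_pow (ν := ν) hδ k
  have hi1 : Integrable ((Set.Ioc τ δ).indicator (fun x : ℝ => x⁻¹ ^ k)) ν := by
    refine ((integrable_truncInv_pow (ν := ν) hτ k).sub hi2).congr (ae_of_all _ fun x => ?_)
    simp [hpt x]
  have heq : ∫ x, truncInv τ x ^ k ∂ν =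
      ∫ x in Set.Ioc τ δ, x⁻¹ ^ k ∂ν + ∫ x, truncInv δ x ^ k ∂ν := by
    rw [← integral_indicator measurableSet_Ioc, ← integral_add hi1 hi2]
    exact integral_congr_ae (ae_of_all _ hpt)
  have h0 : 0 ≤ ∫ x, truncInv δ x ^ k ∂ν :=
    integral_nonneg fun x => pow_nonneg (truncInv_nonneg hδ.le x) k
  have h1 : ∫ x, truncInv δ x ^ k ∂ν ≤ δ⁻¹ ^ k := by
    calc _ ≤ ∫ _, δ⁻¹ ^ k ∂ν := integral_mono hi2 (integrable_const _) fun x =>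
          pow_le_pow_left₀ (truncInv_nonneg hδ.le x) (truncInv_le hδ x) k
      _ = δ⁻¹ ^ k := by simp
  constructor <;> linarith

theorem integrableOn_inv_pow {τ δ : ℝ} (hτ : 0 < τ) (k : ℕ) :
    IntegrableOn (fun x : ℝ => x⁻¹ ^ k) (Set.Ioc τ δ) := by
  refine (ContinuousOn.integrableOn_Icc ?_).mono_set Set.Ioc_subset_Icc_self
  exact (continuousOn_id.inv₀ fun x hx => (hτ.trans_le hx.1).ne').pow k

theorem restrict_Ioc_le_of_restrict_Ioo_le {μ ν : Measure ℝ} {τ δ δ' : ℝ} (hτ : 0 ≤ τ)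
    (hδ : δ < δ') (h : μ.restrict (Set.Ioo 0 δ') ≤ ν.restrict (Set.Ioo 0 δ')) :
    μ.restrict (Set.Ioc τ δ) ≤ ν.restrict (Set.Ioc τ δ) := by
  have hs : Set.Ioc τ δ ⊆ Set.Ioo 0 δ' := fun x hx => ⟨hτ.trans_lt hx.1, hx.2.trans_lt hδ⟩
  have := Measure.restrict_mono (subset_refl (Set.Ioc τ δ)) h
  rwa [Measure.restrict_restrict measurableSet_Ioc, Measure.restrict_restrict measurableSet_Ioc,
    Set.inter_eq_left.2 hs] at this

theorem HasDensityAtZero.exists_Ioc {ν : Measure ℝ} {c η : ℝ} (h : HasDensityAtZero ν c)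
    (hη : 0 < η) : ∃ δ, 0 < δ ∧ ∀ τ, 0 ≤ τ →
      ENNReal.ofReal (c - η) • volume.restrict (Set.Ioc τ δ) ≤ ν.restrict (Set.Ioc τ δ) ∧
      ν.restrict (Set.Ioc τ δ) ≤ ENNReal.ofReal (c + η) • volume.restrict (Set.Ioc τ δ) := by
  obtain ⟨δ, hδ, h1, h2⟩ := h η hη
  refine ⟨δ / 2, by positivity, fun τ hτ => ?_⟩
  rw [← Measure.restrict_smul] at h1 h2 ⊢
  rw [← Measure.restrict_smul]
  exact ⟨restrict_Ioc_le_of_restrict_Ioo_le hτ (by linarith) h1,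
    restrict_Ioc_le_of_restrict_Ioo_le hτ (by linarith) h2⟩

theorem integral_Ioc_inv {τ δ : ℝ} (hτ : 0 < τ) (hτδ : τ ≤ δ) :
    ∫ x in Set.Ioc τ δ, x⁻¹ = Real.log (δ / τ) := by
  rw [← intervalIntegral.integral_of_le hτδ, integral_inv_of_pos hτ (hτ.trans_le hτδ)]

theorem integral_Ioc_inv_sq_le {τ δ : ℝ} (hτ : 0 < τ) (hτδ : τ ≤ δ) :
    ∫ x in Set.Ioc τ δ, x⁻¹ ^ 2 ≤ τ⁻¹ := by
  have hδ : 0 < δ := hτ.trans_le hτδ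
  rw [← intervalIntegral.integral_of_le hτδ]
  have hne : ∀ x ∈ Set.uIcc τ δ, x ≠ 0 := fun x hx => by
    rw [Set.uIcc_of_le hτδ] at hx
    exact (hτ.trans_le hx.1).ne'
  have : ∫ x in τ..δ, x⁻¹ ^ 2 = -δ⁻¹ - -τ⁻¹ := by
    refine intervalIntegral.integral_eq_sub_of_hasDerivAt (f := fun x => -x⁻¹) (fun x hx => ?_) ?_
    · simpa [inv_pow] using (hasDerivAt_inv (hne x hx)).fun_neg
    · exact ((continuousOn_id.inv₀ hne).pow 2).intervalIntegrable
  rw [this]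
  have : 0 < δ⁻¹ := by positivity
  linarith

/-- The truncated first moment grows like `c * log τ⁻¹`. -/
theorem tendsto_integral_truncInv {ν : Measure ℝ} [IsProbabilityMeasure ν] {c : ℝ} (hc : 0 < c)
    (h : HasDensityAtZero ν c) :
    Tendsto (fun τ => (∫ x, truncInv τ x ∂ν) / Real.log τ⁻¹) (𝓝[>] 0) (𝓝 c) := by
  have hloginf : Tendsto (fun τ : ℝ => Real.log τ⁻¹) (𝓝[>] 0) atTop :=
    Real.tendsto_log_atTop.comp tendsto_inv_nhdsGT_zero
  rw [Metric.tendsto_nhds]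
  intro ε hε
  set η := min (ε / 2) (c / 2) with hη
  have hη0 : 0 < η := lt_min (by positivity) (by positivity)
  have hηε : η ≤ ε / 2 := min_le_left _ _
  have hηc : η ≤ c / 2 := min_le_right _ _
  obtain ⟨δ, hδ, hδν⟩ := h.exists_Ioc hη0
  -- `K` bounds the part of the truncated moment that stays bounded as `τ` tends to `0`.
  set K := (c + η) * |Real.log δ| + δ⁻¹ with hK
  filter_upwards [hloginf.eventually_gt_atTop (2 * K / ε), hloginf.eventually_gt_atTop 0,
    Ioo_mem_nhdsGT hδ] with τ h1 h0 hτ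
  obtain ⟨hl, hu⟩ := hδν τ hτ.1.le
  have hlog : Real.log (δ / τ) = Real.log δ + Real.log τ⁻¹ := by
    rw [div_eq_mul_inv, Real.log_mul hδ.ne' (inv_ne_zero hτ.1.ne')]
  have hb := integral_truncInv_pow_bounds (ν := ν) hτ.1 hτ.2 one_ne_zero
  have hint := integrableOn_inv_pow (δ := δ) hτ.1 1
  simp only [pow_one] at hb hint
  have hnn : ∀ᵐ x ∂(volume.restrict (Set.Ioc τ δ)), 0 ≤ x⁻¹ := by
    filter_upwards [ae_restrict_mem measurableSet_Ioc] with x hx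
    exact inv_nonneg.2 (hτ.1.trans hx.1).le
  have hint2 := hint.smul_measure (c := ENNReal.ofReal (c + η)) ENNReal.ofReal_ne_top
  have hnn2 : ∀ᵐ x ∂(ENNReal.ofReal (c + η) • volume.restrict (Set.Ioc τ δ)), 0 ≤ x⁻¹ :=
    Measure.ae_smul_measure hnn _
  have hnnν : ∀ᵐ x ∂(ν.restrict (Set.Ioc τ δ)), 0 ≤ x⁻¹ :=
    (Measure.absolutelyContinuous_of_le hu) hnn2
  have hupper := integral_mono_measure hu hnn2 hint2
  have hlower := integral_mono_measure hl hnnν (hint2.mono_measure hu)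
  rw [integral_smul_measure, integral_Ioc_inv hτ.1 hτ.2.le, hlog, smul_eq_mul,
    ENNReal.toReal_ofReal (by linarith)] at hupper hlower
  have hKl : -K ≤ (c - η) * Real.log δ := by
    have h2 := neg_abs_le (Real.log δ)
    have h3 := abs_nonneg (Real.log δ)
    have : 0 < δ⁻¹ := by positivity
    nlinarith
  have hKu : (c + η) * Real.log δ + δ⁻¹ ≤ K := by
    have h2 := le_abs_self (Real.log δ)
    nlinarith
  rw [div_lt_iff₀ hε] at h1
  rw [Real.dist_eq, abs_lt]
  constructor
  · rw [lt_sub_iff_add_lt, lt_div_iff₀ h0]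
    nlinarith
  · rw [sub_lt_iff_lt_add, div_lt_iff₀ h0]
    nlinarith

/-- The truncated second moment is of order `τ⁻¹`. -/
theorem exists_integral_truncInv_sq_le {ν : Measure ℝ} [IsProbabilityMeasure ν] {c : ℝ}
    (hc : 0 < c) (h : HasDensityAtZero ν c) (h0 : ν (Set.Iic 0) = 0) :
    ∃ C, 0 < C ∧ ∀ᶠ τ in 𝓝[>] (0 : ℝ),
      ∫ x, truncInv τ x ^ 2 ∂ν ≤ C * τ⁻¹ ∧ ν (Set.Iic τ) ≤ ENNReal.ofReal (C * τ) := by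
  obtain ⟨δ, hδ, hδν⟩ := h.exists_Ioc hc
  refine ⟨2 * c + δ⁻¹, by positivity, ?_⟩
  filter_upwards [Ioo_mem_nhdsGT hδ] with τ hτ
  have hδi : 0 < δ⁻¹ := by positivity
  have hτ0 : 0 < τ := hτ.1
  constructor
  · have hu := (hδν τ hτ.1.le).2
    have hb := (integral_truncInv_pow_bounds (ν := ν) hτ.1 hτ.2 two_ne_zero).2
    have hint2 := (integrableOn_inv_pow (δ := δ) hτ.1 2).smul_measure
      (c := ENNReal.ofReal (c + c)) ENNReal.ofReal_ne_top
    have hupper := integral_mono_measure hu (ae_of_all _ fun x => by positivity) hint2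
    rw [integral_smul_measure, smul_eq_mul, ENNReal.toReal_ofReal (by linarith)] at hupper
    have h1 := integral_Ioc_inv_sq_le hτ.1 hτ.2.le
    have h2 : δ⁻¹ ≤ τ⁻¹ := inv_anti₀ hτ.1 hτ.2.le
    nlinarith
  · have hu := (hδν 0 le_rfl).2 (Set.Ioc 0 τ)
    rw [Measure.restrict_apply measurableSet_Ioc, Measure.smul_apply,
      Measure.restrict_apply measurableSet_Ioc,
      Set.inter_eq_left.2 (Set.Ioc_subset_Ioc_right hτ.2.le), Real.volume_Ioc, smul_eq_mul,
      ← ENNReal.ofReal_mul (by linarith), sub_zero] at hu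
    rw [← Set.Iic_union_Ioc_eq_Iic hτ.1.le]
    refine (measure_union_le _ _).trans ?_
    rw [h0, zero_add]
    refine hu.trans (ENNReal.ofReal_le_ofReal ?_)
    nlinarith

/-! ### A weak law of large numbers for the harmonic sum of the gaps -/

/-- The scale `n * log n` for `n = m + 1` concepts. -/
noncomputable def scale (m : ℕ) : ℝ :=
  ((m + 1 : ℕ) : ℝ) * Real.log ((m + 1 : ℕ) : ℝ)

/-- The level `1 / (n * √(log n))`, for `n = m + 1`, at which reciprocals of gaps are truncated.
It is so far below `1 / n` that with high probability no gap is smaller, and so close to `1 / n`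
that the variance of the truncated harmonic sum is negligible against `(n * log n) ^ 2`. -/
noncomputable def cutoff (m : ℕ) : ℝ :=
  (((m + 1 : ℕ) : ℝ) * √(Real.log ((m + 1 : ℕ) : ℝ)))⁻¹

theorem tendsto_natCast_add_one : Tendsto (fun m : ℕ => ((m + 1 : ℕ) : ℝ)) atTop atTop :=
  tendsto_natCast_atTop_atTop.comp (tendsto_add_atTop_nat 1)

theorem tendsto_log_natCast_add_one :
    Tendsto (fun m : ℕ => Real.log ((m + 1 : ℕ) : ℝ)) atTop atTop :=
  Real.tendsto_log_atTop.comp tendsto_natCast_add_one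

theorem tendsto_sqrt_log_natCast_add_one :
    Tendsto (fun m : ℕ => √(Real.log ((m + 1 : ℕ) : ℝ))) atTop atTop :=
  Real.tendsto_sqrt_atTop.comp tendsto_log_natCast_add_one

theorem tendsto_scale : Tendsto scale atTop atTop :=
  tendsto_natCast_add_one.atTop_mul_atTop₀ tendsto_log_natCast_add_one

theorem tendsto_cutoff : Tendsto cutoff atTop (𝓝[>] 0) :=
  tendsto_inv_atTop_nhdsGT_zero.comp
    (tendsto_natCast_add_one.atTop_mul_atTop₀ tendsto_sqrt_log_natCast_add_one)

theorem tendsto_scale_mul_cutoff : Tendsto (fun m => scale m * cutoff m) atTop atTop := by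
  refine tendsto_sqrt_log_natCast_add_one.congr' ?_
  filter_upwards [tendsto_log_natCast_add_one.eventually_gt_atTop 0] with m hm
  have h1 : 0 < √(Real.log ((m + 1 : ℕ) : ℝ)) := Real.sqrt_pos.2 hm
  have h2 : (0 : ℝ) < ((m + 1 : ℕ) : ℝ) := by positivity
  rw [scale, cutoff]
  nth_rewrite 2 [← Real.mul_self_sqrt hm.le]
  field_simp

theorem tendsto_log_inv_cutoff_div :
    Tendsto (fun m => Real.log (cutoff m)⁻¹ / Real.log ((m + 1 : ℕ) : ℝ)) atTop (𝓝 1) := by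
  have h := Real.isLittleO_log_id_atTop.tendsto_div_nhds_zero.comp tendsto_log_natCast_add_one
  have h' := (h.const_mul (1 / 2)).const_add 1
  rw [mul_zero, add_zero] at h'
  refine h'.congr' ?_
  filter_upwards [tendsto_log_natCast_add_one.eventually_gt_atTop 0] with m hm
  have h1 : 0 < √(Real.log ((m + 1 : ℕ) : ℝ)) := Real.sqrt_pos.2 hm
  have h2 : (0 : ℝ) < ((m + 1 : ℕ) : ℝ) := by positivity
  rw [cutoff, inv_inv, Real.log_mul h2.ne' h1.ne', Real.log_sqrt hm.le, add_div, div_self hm.ne']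
  simp only [Function.comp, id]
  ring

/-- The event of high probability on which the asymptotics are deterministic: all gaps lie between
the cutoff and `1`, and their harmonic sum is close to `c * scale m`. -/
def goodEvent {Ω : Type*} (X : ℕ → Ω → ℝ) (c η : ℝ) (m : ℕ) : Set Ω :=
  {ω | (∀ i : Fin m, cutoff m ≤ X i ω ∧ X i ω ≤ 1) ∧
    |(∑ i : Fin m, (X i ω)⁻¹) / scale m - c| ≤ η}

variable {Ω : Type*} [MeasurableSpace Ω] {P : Measure Ω} [IsProbabilityMeasure P]
  {X : ℕ → Ω → ℝ} {ν : Measure ℝ} {c : ℝ}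

theorem integral_sum_truncInv (hX : ∀ i, Measurable (X i)) (hν : ∀ i, P.map (X i) = ν)
    {τ : ℝ} (m : ℕ) (hτ : 0 < τ) :
    ∫ ω, (∑ i ∈ Finset.range m, fun ω => truncInv τ (X i ω)) ω ∂P =
      m * ∫ x, truncInv τ x ∂ν := by
  have hint : ∀ i, ∫ ω, truncInv τ (X i ω) ∂P = ∫ x, truncInv τ x ∂ν := fun i => by
    rw [← hν i, integral_map (hX i).aemeasurable (measurable_truncInv τ).aestronglyMeasurable]
  simp only [Finset.sum_apply]
  rw [integral_finsetSum]
  · simp [hint]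
  · intro i _
    have : IsProbabilityMeasure ν := hν i ▸ Measure.isProbabilityMeasure_map (hX i).aemeasurable
    have h1 := integrable_truncInv_pow (ν := ν) hτ 1
    simp only [pow_one] at h1
    rw [← hν i] at h1
    exact h1.comp_measurable (hX i)

theorem variance_sum_truncInv_le (hX : ∀ i, Measurable (X i)) (hindep : iIndepFun X P)
    (hν : ∀ i, P.map (X i) = ν) {τ : ℝ} (hτ : 0 < τ) (m : ℕ) :
    MemLp (∑ i ∈ Finset.range m, fun ω => truncInv τ (X i ω)) 2 P ∧
    variance (∑ i ∈ Finset.range m, fun ω => truncInv τ (X i ω)) P ≤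
      m * ∫ x, truncInv τ x ^ 2 ∂ν := by
  have hmem : ∀ i, MemLp (fun ω => truncInv τ (X i ω)) 2 P := fun i =>
    MemLp.of_bound ((measurable_truncInv τ).comp (hX i)).aestronglyMeasurable τ⁻¹
      (ae_of_all _ fun ω => by
        rw [Real.norm_of_nonneg (truncInv_nonneg hτ.le _)]
        exact truncInv_le hτ _)
  refine ⟨memLp_finsetSum' _ fun i _ => hmem i, ?_⟩
  rw [IndepFun.variance_sum (fun i _ => hmem i) fun i _ j _ hij =>
    (hindep.indepFun hij).comp (measurable_truncInv τ) (measurable_truncInv τ)]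
  calc _ ≤ ∑ i ∈ Finset.range m, ∫ x, truncInv τ x ^ 2 ∂ν := by
        refine Finset.sum_le_sum fun i _ => ?_
        refine (variance_le_expectation_sq (hmem i).aestronglyMeasurable).trans_eq ?_
        rw [← hν i, integral_map (hX i).aemeasurable
          ((measurable_truncInv τ).pow_const 2).aestronglyMeasurable]
        rfl
    _ = _ := by simp

/-- If no gap is below the cutoff, the harmonic sum is the truncated one, whose fluctuations are
controlled by Chebyshev's inequality. -/
theorem measure_compl_goodEvent_le (hX : ∀ i, Measurable (X i)) (hindep : iIndepFun X P)
    (hν : ∀ i, P.map (X i) = ν) (h1 : ν (Set.Ioi 1) = 0) {η : ℝ} (hη : 0 < η) {m : ℕ}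
    (hτ : 0 < cutoff m) (hM : 0 < scale m)
    (hE : |m * (∫ x, truncInv (cutoff m) x ∂ν) / scale m - c| ≤ η / 2) :
    P (goodEvent X c η m)ᶜ ≤ m * ν (Set.Iic (cutoff m)) +
      ENNReal.ofReal (m * (∫ x, truncInv (cutoff m) x ^ 2 ∂ν) / (η / 2 * scale m) ^ 2) := by
  set τ := cutoff m with hτdef
  set Y : Ω → ℝ := ∑ i ∈ Finset.range m, fun ω => truncInv τ (X i ω) with hY
  obtain ⟨hmem, hvar⟩ := variance_sum_truncInv_le hX hindep hν hτ m
  rw [← hY] at hmem hvar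
  have hEY : ∫ ω, Y ω ∂P = m * ∫ x, truncInv τ x ∂ν := integral_sum_truncInv hX hν m hτ
  have hpos : 0 < η / 2 * scale m := by positivity
  have hsub : (goodEvent X c η m)ᶜ ⊆
      ((⋃ i ∈ Finset.range m, X i ⁻¹' Set.Iic τ) ∪ ⋃ i ∈ Finset.range m, X i ⁻¹' Set.Ioi 1) ∪
        {ω | η / 2 * scale m ≤ |Y ω - ∫ ω, Y ω ∂P|} := by
    intro ω hω
    by_contra hcon
    refine hω ?_
    simp only [Set.mem_union, Set.mem_iUnion, Set.mem_preimage, Set.mem_Iic, Set.mem_Ioi,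
      Set.mem_ofPred_eq, not_or, not_exists, not_le, not_lt, Finset.mem_range] at hcon
    obtain ⟨⟨hc1, hc2⟩, hc3⟩ := hcon
    refine ⟨fun i => ⟨(hc1 i i.2).le, hc2 i i.2⟩, ?_⟩
    have hsum : ∑ i : Fin m, (X i ω)⁻¹ = Y ω := by
      rw [Fin.sum_univ_eq_sum_range (fun i => (X i ω)⁻¹), hY, Finset.sum_apply]
      exact Finset.sum_congr rfl fun i hi => (truncInv_of_lt (hc1 i (Finset.mem_range.1 hi))).symm
    rw [hsum]
    rw [hEY] at hc3
    have h2 : |Y ω / scale m - m * (∫ x, truncInv τ x ∂ν) / scale m| ≤ η / 2 := by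
      rw [← sub_div, abs_div, abs_of_pos hM, div_le_iff₀ hM]
      exact hc3.le
    calc _ ≤ _ := abs_sub_le _ (m * (∫ x, truncInv τ x ∂ν) / scale m) _
      _ ≤ η / 2 + η / 2 := add_le_add h2 hE
      _ = η := by ring
  refine (measure_mono hsub).trans ((measure_union_le _ _).trans (add_le_add
    ((measure_union_le _ _).trans ?_) ?_))
  · have ha : P (⋃ i ∈ Finset.range m, X i ⁻¹' Set.Iic τ) ≤ m * ν (Set.Iic τ) := by
      refine (measure_biUnion_finset_le _ _).trans_eq ?_
      rw [Finset.sum_congr rfl fun i _ => by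
        rw [← Measure.map_apply (hX i) measurableSet_Iic, hν i]]
      simp
    have hb : P (⋃ i ∈ Finset.range m, X i ⁻¹' Set.Ioi 1) ≤ 0 := by
      refine (measure_biUnion_finset_le _ _).trans_eq ?_
      rw [Finset.sum_congr rfl fun i _ => by
        rw [← Measure.map_apply (hX i) measurableSet_Ioi, hν i, h1]]
      simp
    calc _ ≤ m * ν (Set.Iic τ) + 0 := add_le_add ha hb
      _ = _ := add_zero _
  · refine (meas_ge_le_variance_div_sq hmem hpos).trans (ENNReal.ofReal_le_ofReal ?_)
    exact div_le_div_of_nonneg_right hvar (by positivity)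

theorem tendsto_measure_compl_goodEvent (hX : ∀ i, Measurable (X i)) (hindep : iIndepFun X P)
    (hν : ∀ i, P.map (X i) = ν) (hc : 0 < c) (h : HasDensityAtZero ν c)
    (h0 : ν (Set.Iic 0) = 0) (h1 : ν (Set.Ioi 1) = 0) {η : ℝ} (hη : 0 < η) :
    Tendsto (fun m => P (goodEvent X c η m)ᶜ) atTop (𝓝 0) := by
  have : IsProbabilityMeasure ν := hν 0 ▸ Measure.isProbabilityMeasure_map (hX 0).aemeasurable
  obtain ⟨C, hC, hCτ⟩ := exists_integral_truncInv_sq_le hc h h0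
  have hdiv : Tendsto (fun m : ℕ => (m : ℝ) / ((m + 1 : ℕ) : ℝ)) atTop (𝓝 1) := by
    simpa using tendsto_natCast_div_add_atTop (1 : ℝ)
  have hmean : Tendsto (fun m : ℕ => m * (∫ x, truncInv (cutoff m) x ∂ν) / scale m)
      atTop (𝓝 c) := by
    have h2 := (hdiv.mul ((tendsto_integral_truncInv hc h).comp tendsto_cutoff)).mul
      tendsto_log_inv_cutoff_div
    rw [one_mul, mul_one] at h2
    refine h2.congr' ?_
    filter_upwards [tendsto_log_natCast_add_one.eventually_gt_atTop 0,
      (Real.tendsto_log_atTop.comp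
        (tendsto_inv_nhdsGT_zero.comp tendsto_cutoff)).eventually_gt_atTop 0] with m hm hm2
    simp only [Function.comp] at hm2 ⊢
    generalize Real.log (cutoff m)⁻¹ = w at hm2 ⊢
    rw [scale]
    field_simp
  have hbound : Tendsto (fun m : ℕ => ENNReal.ofReal (C / √(Real.log ((m + 1 : ℕ) : ℝ))) +
      ENNReal.ofReal (4 * C / η ^ 2 / √(Real.log ((m + 1 : ℕ) : ℝ)))) atTop (𝓝 0) := by
    have h3 : ∀ K : ℝ, Tendsto (fun m : ℕ => ENNReal.ofReal
        (K / √(Real.log ((m + 1 : ℕ) : ℝ)))) atTop (𝓝 0) := fun K => by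
      have := ENNReal.tendsto_ofReal
        (tendsto_sqrt_log_natCast_add_one.const_div_atTop K)
      rwa [ENNReal.ofReal_zero] at this
    simpa using (h3 C).add (h3 (4 * C / η ^ 2))
  refine tendsto_of_tendsto_of_tendsto_of_le_of_le' tendsto_const_nhds hbound
    (Eventually.of_forall fun _ => zero_le) ?_
  filter_upwards [tendsto_cutoff.eventually hCτ, tendsto_cutoff.eventually self_mem_nhdsWithin,
    tendsto_scale.eventually_gt_atTop 0, tendsto_sqrt_log_natCast_add_one.eventually_ge_atTop 1,
    hmean.eventually (Metric.closedBall_mem_nhds c (half_pos hη))] with m hm hτ hM hL hE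
  refine (measure_compl_goodEvent_le hX hindep hν h1 hη hτ hM hE).trans (add_le_add ?_ ?_)
  · calc (m : ENNReal) * ν (Set.Iic (cutoff m))
      _ ≤ ENNReal.ofReal m * ENNReal.ofReal (C * cutoff m) := by
        rw [ENNReal.ofReal_natCast]
        exact mul_le_mul_right hm.2 _
      _ = ENNReal.ofReal (m * (C * cutoff m)) := (ENNReal.ofReal_mul (Nat.cast_nonneg m)).symm
      _ ≤ _ := by
        refine ENNReal.ofReal_le_ofReal ?_
        rw [cutoff, mul_inv, div_eq_mul_inv]
        have h2 : (m : ℝ) * ((m + 1 : ℕ) : ℝ)⁻¹ ≤ 1 := by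
          rw [← div_eq_mul_inv]
          exact div_le_one_of_le₀ (by push_cast; linarith) (by positivity)
        have h4 : 0 ≤ C * (√(Real.log ((m + 1 : ℕ) : ℝ)))⁻¹ := by positivity
        nlinarith
  · refine ENNReal.ofReal_le_ofReal ?_
    set L := √(Real.log ((m + 1 : ℕ) : ℝ)) with hLdef
    have hn : (0 : ℝ) < ((m + 1 : ℕ) : ℝ) := by positivity
    have hmn : (m : ℝ) ≤ ((m + 1 : ℕ) : ℝ) := by push_cast; linarith
    have hlogpos : 0 < Real.log ((m + 1 : ℕ) : ℝ) := Real.sqrt_pos.1 (by rw [← hLdef]; linarith)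
    have hLL : Real.log ((m + 1 : ℕ) : ℝ) = L * L := (Real.mul_self_sqrt hlogpos.le).symm
    have hJ : (∫ x, truncInv (cutoff m) x ^ 2 ∂ν) ≤ C * (((m + 1 : ℕ) : ℝ) * L) := by
      have := hm.1
      rwa [cutoff, inv_inv] at this
    have hL0 : 0 < L := by linarith
    calc _ ≤ ((m + 1 : ℕ) : ℝ) * (C * (((m + 1 : ℕ) : ℝ) * L)) / (η / 2 * scale m) ^ 2 := by
          refine div_le_div_of_nonneg_right ?_ (by positivity)
          exact mul_le_mul hmn hJ (integral_nonneg fun x => by positivity) hn.le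
      _ = 4 * C / η ^ 2 / L / L ^ 2 := by
          rw [scale, hLL]
          field_simp
          ring
      _ ≤ 4 * C / η ^ 2 / L := div_le_self (by positivity) (one_le_pow₀ hL)

/-! ### Asymptotics on the good event -/

theorem goodEvent_sum_bounds {Ω : Type*} {X : ℕ → Ω → ℝ} {c η R : ℝ} {m : ℕ} {ω : Ω}
    (hη : η ≤ c / 2) (hM : 0 < scale m) (hτ : 0 < cutoff m)
    (hR : R ≤ c / 2 * (scale m * cutoff m)) (h : ω ∈ goodEvent X c η m) :
    (c - η) * scale m ≤ ∑ i : Fin m, (X i ω)⁻¹ ∧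
    ∑ i : Fin m, (X i ω)⁻¹ ≤ (c + η) * scale m ∧
    R ≤ (∑ i : Fin m, (X i ω)⁻¹) * cutoff m := by
  obtain ⟨h1, h2⟩ := abs_le.1 h.2
  rw [le_sub_iff_add_le, le_div_iff₀ hM] at h1
  rw [sub_le_iff_le_add, div_le_iff₀ hM] at h2
  refine ⟨by linarith, by linarith, hR.trans ?_⟩
  rw [← mul_assoc]
  refine mul_le_mul_of_nonneg_right ?_ hτ.le
  nlinarith

/-- On the good event `S = ∑ i, (X i)⁻¹` lies between `c / 2` and `3 * c / 2` times the scale, and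
the learning time between `|log Δ| * S / 8` and `2 * |log Δ| * S + 1`; the constants `c / 32` and
`4 * c` leave room for strictness and for the additive `1`. -/
theorem eventually_learningTime_bounds {Ω : Type*} (X : ℕ → Ω → ℝ) {c Δ : ℝ} (hc : 0 < c)
    (hΔ0 : 0 < Δ) (hΔ1 : Δ < 1) :
    ∀ᶠ m in atTop, ∀ ω ∈ goodEvent X c (c / 2) m,
      c / 32 < (learningTime (gapOverlaps fun i : Fin m => X i ω) Δ : ℝ) /
        (|Real.log Δ| * scale m) ∧
      (learningTime (gapOverlaps fun i : Fin m => X i ω) Δ : ℝ) /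
        (|Real.log Δ| * scale m) < 4 * c := by
  have hlog : 0 < |Real.log Δ| := abs_pos.2 (Real.log_neg hΔ0 hΔ1).ne
  have hs : √Δ < 1 := by
    rw [Real.sqrt_lt' one_pos]
    simpa using hΔ1
  have hs' : 0 < 1 - √Δ := by linarith
  filter_upwards [tendsto_scale.eventually_ge_atTop (8 / c),
    tendsto_scale.eventually_gt_atTop (1 / (c * |Real.log Δ|)),
    tendsto_cutoff.eventually self_mem_nhdsWithin,
    (tendsto_scale_mul_cutoff.const_mul_atTop (half_pos hc)).eventually_ge_atTop
      (max 2 (1 - √Δ)⁻¹)] with m hM1 hM2 hτ hR ω hω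
  have hM : 0 < scale m := lt_of_lt_of_le (by positivity) hM1
  obtain ⟨h1, h2, h3⟩ := goodEvent_sum_bounds le_rfl hM hτ hR hω
  rw [div_le_iff₀ hc] at hM1
  rw [div_lt_iff₀ (by positivity)] at hM2
  obtain ⟨h4, h5⟩ := learningTime_bounds hτ (fun i => (hω.1 i).1) (fun i => (hω.1 i).2) rfl
    ((le_max_left _ _).trans h3) (by linarith) hΔ0 hΔ1 (by
      have := inv_anti₀ (inv_pos.2 hs') ((le_max_right _ _).trans h3)
      rw [inv_inv] at this
      linarith)
  have hD : 0 < |Real.log Δ| * scale m := by positivity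
  constructor
  · rw [lt_div_iff₀ hD]
    have := mul_le_mul_of_nonneg_left h1 hlog.le
    have : 0 < c * (|Real.log Δ| * scale m) := by positivity
    linarith
  · rw [div_lt_iff₀ hD]
    have := mul_le_mul_of_nonneg_left h2 hlog.le
    linarith

theorem eventually_inv_muStar_bounds {Ω : Type*} (X : ℕ → Ω → ℝ) {c ε : ℝ} (hc : 0 < c)
    (hε : 0 < ε) :
    ∀ᶠ m in atTop, ∀ ω ∈ goodEvent X c (min (c / 2) (ε / 2)) m,
      |(muStar (gapOverlaps fun i : Fin m => X i ω))⁻¹ / scale m - c| ≤ ε := by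
  filter_upwards [tendsto_scale.eventually_gt_atTop 0,
    tendsto_cutoff.eventually self_mem_nhdsWithin,
    (tendsto_scale_mul_cutoff.const_mul_atTop (half_pos hc)).eventually_ge_atTop
      (2 * (c + ε) / ε)] with m hM hτ hR ω hω
  have hη : min (c / 2) (ε / 2) ≤ ε / 2 := min_le_right _ _
  obtain ⟨h1, h2, h3⟩ := goodEvent_sum_bounds (min_le_left _ _) hM hτ hR hω
  set S := ∑ i : Fin m, (X i ω)⁻¹
  have h4 : 1 < 2 * (c + ε) / ε := by
    rw [one_lt_div hε]
    linarith
  obtain ⟨h5, h6⟩ := inv_muStar_bounds hτ (fun i => (hω.1 i).1) rfl (h4.trans_le h3)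
  have hr : (S * cutoff m)⁻¹ ≤ ε / (2 * (c + ε)) := by
    have := inv_anti₀ (by positivity) h3
    rwa [inv_div] at this
  have hr' : (c + ε) * (S * cutoff m)⁻¹ ≤ ε / 2 := by
    calc _ ≤ (c + ε) * (ε / (2 * (c + ε))) := mul_le_mul_of_nonneg_left hr (by positivity)
      _ = ε / 2 := by field_simp
  have hr1 : 0 < 1 - (S * cutoff m)⁻¹ := sub_pos.2 (inv_lt_one_of_one_lt₀ (h4.trans_le h3))
  -- The factor `(1 - (S * cutoff m)⁻¹)⁻¹` uses up the second half of `ε`.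
  have h7 : S / (1 - (S * cutoff m)⁻¹) ≤ (c + ε) * scale m := by
    rw [div_le_iff₀ hr1]
    nlinarith
  rw [abs_le]
  constructor
  · rw [le_sub_iff_add_le, le_div_iff₀ hM]
    refine le_trans ?_ h5
    nlinarith
  · rw [sub_le_iff_le_add, div_le_iff₀ hM]
    refine (h6.trans h7).trans_eq ?_
    ring

theorem overlaps_eq_gapOverlaps (a : ℕ → ℝ) (m : ℕ) :
    overlaps a m = gapOverlaps fun i : Fin m => 1 - a i := by
  simp [overlaps, gapOverlaps]

theorem withDensity_Iic_zero (f : ℝ → ENNReal) :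
    ((volume.restrict (Set.Icc (0 : ℝ) 1)).withDensity f) (Set.Iic 0) = 0 := by
  refine withDensity_absolutelyContinuous _ _ ?_
  rw [Measure.restrict_apply measurableSet_Iic]
  refine measure_mono_null (t := {0}) (fun x hx => ?_) Real.volume_singleton
  exact le_antisymm hx.1 hx.2.1

theorem withDensity_Ioi_one (f : ℝ → ENNReal) :
    ((volume.restrict (Set.Icc (0 : ℝ) 1)).withDensity f) (Set.Ioi 1) = 0 := by
  refine withDensity_absolutelyContinuous _ _ ?_
  rw [Measure.restrict_apply measurableSet_Ioi]
  refine measure_mono_null (t := ∅) (fun x hx => ?_) measure_empty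
  exact absurd hx.2.2 (not_le.2 hx.1)

end MemorylessLearner

/-- The number of concepts is `n = m + 1`. The variables `1 - a i` are i.i.d. in `[0, 1]` with
density `f`, and `f x → c > 0` as `x → 0`. -/
theorem mainTheorem1 {Ω : Type*} [MeasurableSpace Ω] (P : Measure Ω) [IsProbabilityMeasure P]
    (f : ℝ → ℝ) (hf : Measurable f) (hf_nonneg : ∀ x, 0 ≤ f x)
    (c : ℝ) (hc : 0 < c) (hfc : Tendsto f (𝓝[>] 0) (𝓝 c))
    (a : ℕ → Ω → ℝ) (ha : ∀ i, Measurable (a i)) (ha_indep : iIndepFun a P)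
    (ha_law : ∀ i, P.map (fun ω => 1 - a i ω) =
      (volume.restrict (Set.Icc (0 : ℝ) 1)).withDensity fun x => ENNReal.ofReal (f x)) :
    (∃ C₁ C₂ : ℝ, 0 < C₁ ∧ 0 < C₂ ∧ ∀ Δ : ℝ, 0 < Δ → Δ < 1 →
      Tendsto (fun m : ℕ => P {ω |
          C₁ < (MemorylessLearner.learningTime
                  (MemorylessLearner.overlaps (fun i => a i ω) m) Δ : ℝ) /
                (|Real.log Δ| * ((m + 1 : ℕ) * Real.log (m + 1 : ℕ))) ∧
          (MemorylessLearner.learningTime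
                  (MemorylessLearner.overlaps (fun i => a i ω) m) Δ : ℝ) /
                (|Real.log Δ| * ((m + 1 : ℕ) * Real.log (m + 1 : ℕ))) < C₂})
        atTop (𝓝 1)) ∧
    (∀ ε : ℝ, 0 < ε →
      Tendsto (fun m : ℕ => P {ω |
          ε < |(MemorylessLearner.muStar
                  (MemorylessLearner.overlaps (fun i => a i ω) m))⁻¹ /
                ((m + 1 : ℕ) * Real.log (m + 1 : ℕ)) - c|})
        atTop (𝓝 0)) := by
  set X : ℕ → Ω → ℝ := fun i ω => 1 - a i ω with hX
  have hXm : ∀ i, Measurable (X i) := fun i => measurable_const.sub (ha i)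
  have hindep : iIndepFun X P :=
    ha_indep.comp (fun _ x => 1 - x) fun _ => measurable_const.sub measurable_id
  have hgood : ∀ η, 0 < η →
      Tendsto (fun m => P (MemorylessLearner.goodEvent X c η m)ᶜ) atTop (𝓝 0) := fun η hη =>
    MemorylessLearner.tendsto_measure_compl_goodEvent hXm hindep ha_law hc
      (MemorylessLearner.hasDensityAtZero_withDensity hfc)
      (MemorylessLearner.withDensity_Iic_zero _) (MemorylessLearner.withDensity_Ioi_one _) hη
  simp only [MemorylessLearner.overlaps_eq_gapOverlaps]
  refine ⟨⟨c / 32, 4 * c, by positivity, by positivity, fun Δ hΔ0 hΔ1 => ?_⟩, fun ε hε => ?_⟩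
  · have hlim := ENNReal.Tendsto.sub (tendsto_const_nhds (x := (1 : ENNReal)))
      (hgood (c / 2) (by positivity)) (Or.inl ENNReal.one_ne_top)
    rw [tsub_zero] at hlim
    refine tendsto_of_tendsto_of_tendsto_of_le_of_le' hlim tendsto_const_nhds ?_
      (Eventually.of_forall fun _ => prob_le_one)
    filter_upwards [MemorylessLearner.eventually_learningTime_bounds X hc hΔ0 hΔ1] with m hm
    -- Subadditivity holds for sets that are not known to be measurable.
    refine tsub_le_iff_right.2 ?_
    calc (1 : ENNReal) = P Set.univ := measure_univ.symm
      _ ≤ _ := measure_mono ?_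
      _ ≤ _ := measure_union_le _ _
    intro ω _
    by_cases hω : ω ∈ MemorylessLearner.goodEvent X c (c / 2) m
    · exact Or.inl (hm ω hω)
    · exact Or.inr hω
  · refine tendsto_of_tendsto_of_tendsto_of_le_of_le' tendsto_const_nhds
      (hgood (min (c / 2) (ε / 2)) (by positivity)) (Eventually.of_forall fun _ => zero_le) ?_
    filter_upwards [MemorylessLearner.eventually_inv_muStar_bounds X hc hε] with m hm
    refine measure_mono fun ω hω hgoodω => ?_
    exact absurd (hm ω hgoodω) (not_le.2 hω)
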